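/- Let $\mathbb{T}$ be the unit circle with normalised Lebesgue measure $m$, and let $\{\mathscr{L}_\gamma=(\mathbb{C}^N,\|\cdot\|_\gamma):\gamma\in\mathbb{T}\}$ be an interpolation family: each $\|\cdot\|_\gamma$ is a norm on $\mathbb{C}^N$, and for every $x\in\mathbb{C}^N$ the function $\gamma\mapsto\|x\|_\gamma$ is measurable with $\int\log^+\|x\|_\gamma\,dm(\gamma)<\infty$. Assume that it is a family of compatible Banach lattices with respect to a basis $(e_1,\dots,e_N)$ of $\mathbb{C}^N$ (for instance the canonical basis): writing $x=\sum_k x_ke_k$, for almost every $\gamma$ one has $\|x\|_\gamma\le\|y\|_\gamma$ whenever $|x_k|\le|y_k|$ for all $k$, and $$0<\operatorname*{ess\,inf}_{\gamma}\|e_k\|_\gamma\le\operatorname*{ess\,sup}_{\gamma}\|e_k\|_\gamma<\infty\qquad(1\le k\le N).$$ For $x\in\mathbb{C}^N$ let $$\|x\|_{\mathscr{L}[0]}=\inf\Big\{\operatorname*{ess\,sup}_{\gamma\in\mathbb{T}}\|f(\gamma)\|_\gamma \;:\; f:\mathbb{T}\to\mathbb{C}^N\text{ analytic},\ f(0)=x\Big\},$$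 where $f$ is called analytic if it is integrable with $\hat f(n)=0$ for all $n<0$, and $f(0):=\hat f(0)$. Then, with the convention $\log 0=-\infty$, for every $x\in\mathbb{C}^N$, $$\log\|x\|_{\mathscr{L}[0]}=\inf_f\int\log\|f(\gamma)\|_\gamma\,dm(\gamma),$$ where the infimum runs over all measurable functions $f=\sum_k f_ke_k:\mathbb{T}\to\mathbb{C}^N$ with bounded coordinates $f_k$ such that $\log|x_k|\le\int\log|f_k(\gamma)|\,dm(\gamma)$ for all $1\le k\le N$. In particular, if $M:\mathbb{T}\to\mathbb{T}$ is measure preserving and $\widetilde{\mathscr{L}}_\gamma=\mathscr{L}_{M(\gamma)}$, then $\|x\|_{\widetilde{\mathscr{L}}[0]}=\|x\|_{\mathscr{L}[0]}$ for every $x\in\mathbb{C}^N$, i.e. the identity $\mathscr{L}[0]\to\widetilde{\mathscr{L}}[0]$ is isometric. -/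

import Mathlib

open MeasureTheory
open scoped ENNReal

namespace LatticeInterp

/-- The unit circle, parametrised as `ℝ / ℤ` by `t ↦ exp (2 π i t)`. -/
abbrev 𝕋 : Type := UnitAddCircle

/-- The normalised Lebesgue measure on the circle. -/
noncomputable abbrev m : Measure 𝕋 := AddCircle.haarAddCircle

/-- A family of norms on `ℂ^N` indexed by the circle, measurable in the sense that `γ ↦ ‖x‖_γ` is
(Lebesgue) measurable for every `x`, and with `∫ log⁺ ‖x‖_γ dm(γ) < ∞` for every `x`. -/
structure IsInterpolationFamily {N : ℕ} (E : 𝕋 → Seminorm ℂ (Fin N → ℂ)) : Prop where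
  definite : ∀ γ x, E γ x = 0 → x = 0
  measurable : ∀ x, AEMeasurable (fun γ => E γ x) m
  integrable_posLog : ∀ x, Integrable (fun γ => Real.posLog (E γ x)) m

/-- The lattice axiom for a norm `p` on `ℂ^N` with respect to the basis `b`. -/
def IsLatticeNorm {N : ℕ} (b : Module.Basis (Fin N) ℂ (Fin N → ℂ))
    (p : Seminorm ℂ (Fin N → ℂ)) : Prop :=
  ∀ x y : Fin N → ℂ, (∀ k, ‖b.repr x k‖ ≤ ‖b.repr y k‖) → p x ≤ p y

/-- The norms of the family `E` are compatible Banach lattice norms, with common lattice-basis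
`b`. -/
structure IsCompatibleLatticeFamily {N : ℕ} (b : Module.Basis (Fin N) ℂ (Fin N → ℂ))
    (E : 𝕋 → Seminorm ℂ (Fin N → ℂ)) : Prop where
  lattice : ∀ᵐ γ ∂m, IsLatticeNorm b (E γ)
  essInf_pos : ∀ k, 0 < essInf (fun γ => ENNReal.ofReal (E γ (b k))) m
  essSup_lt_top : ∀ k, essSup (fun γ => ENNReal.ofReal (E γ (b k))) m < ⊤

/-- Analytic functions on the circle: the integrable functions whose Fourier coefficients of
negative index vanish, i.e. the boundary values of functions of the Hardy space `H¹`. The value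
at `0` of the analytic extension to the disc is the Fourier coefficient of index `0`.
Boundedness is not required here. (If the norms `‖·‖_γ` are uniformly bounded below, as for
compatible lattices, those `f` for which `ess sup ‖f(γ)‖_γ` is finite are automatically boundary
values of bounded analytic functions.) -/
def IsAnalyticOnCircle {N : ℕ} (f : 𝕋 → Fin N → ℂ) : Prop :=
  Integrable f m ∧ ∀ n : ℤ, n < 0 → fourierCoeff f n = 0

/-- The norm of `x` in the interpolated space `E[0]`: the infimum of `ess sup ‖f(γ)‖_γ` over the
analytic functions `f` with `f(0) = x`. -/
noncomputable def interpNormZero {N : ℕ} (E : 𝕋 → Seminorm ℂ (Fin N → ℂ))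
    (x : Fin N → ℂ) : ℝ≥0∞ :=
  ⨅ (f : 𝕋 → Fin N → ℂ) (_ : IsAnalyticOnCircle f ∧ fourierCoeff f 0 = x),
    essSup (fun γ => ENNReal.ofReal (E γ (f γ))) m

/-- `∫ log g dm` as an extended real number, with the convention `log 0 = -∞`: the integral of
the positive part minus the integral of the negative part. -/
noncomputable def logIntegral (g : 𝕋 → ℝ) : EReal :=
  ((∫⁻ γ, (ENNReal.log (ENNReal.ofReal (g γ))).toENNReal ∂m : ℝ≥0∞) : EReal) -
    ((∫⁻ γ, (-ENNReal.log (ENNReal.ofReal (g γ))).toENNReal ∂m : ℝ≥0∞) : EReal)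

/-- The measurable functions on the circle with bounded coordinates in the basis `b` such that
`log |x| ≤ ∫ log |f(γ)| dm(γ)` coordinatewise. -/
structure IsAdmissible {N : ℕ} (b : Module.Basis (Fin N) ℂ (Fin N → ℂ)) (x : Fin N → ℂ)
    (f : 𝕋 → Fin N → ℂ) : Prop where
  measurable : AEMeasurable f m
  bounded : ∀ k, ∃ C : ℝ, ∀ γ, ‖b.repr (f γ) k‖ ≤ C
  log_le : ∀ k, ENNReal.log (ENNReal.ofReal ‖b.repr x k‖) ≤
    logIntegral (fun γ => ‖b.repr (f γ) k‖)

end LatticeInterp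

/-!
The formula reduces the vector-valued extremal problem to scalar outer functions.

If `f` has bounded coordinates with `log |x_k| ≤ ∫ log |f_k|` and `u γ = ‖f γ‖_γ`, there are outer
functions `G_k` with `|G_k| = exp (∫ log u) |f_k| / u` and `G_k(0) = exp (∫ log |f_k|)`. The analytic
function with coordinates `(x_k / G_k(0)) G_k` takes the value `x` at `0`, and the lattice property
bounds its norm by `exp (∫ log u)` almost everywhere
(`IsRegularLatticeFamily.log_interpNormZero_le`). Replacing `|f_k|` by `|f_k| + ε` keeps all
logarithms bounded, so that only bounded outer functions are needed (`exists_outer`). They are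
limits of `exp q` for analytic polynomials `q`, real at `0`, whose real parts approximate a bounded
function `v` in `L²`: since `∫ q² = q(0)² ≥ 0`, the imaginary parts converge as well. Conversely,
an analytic function through `x` of finite norm is itself admissible, by Jensen's inequality
(`IsHardy.log_norm_integral_le`), and its logarithmic mean is at most the logarithm of its
essential supremum.

For a measure-preserving `M`, composition with `M` maps admissible functions for `E` to admissible
functions for `γ ↦ E (M γ)`. Since `M` need not be invertible, the reverse inequality
(`IsRegularLatticeFamily.interpNormZero_le_comp`) averages the moduli `|f_k|` over the fibres of `M`
with the regular conditional distribution given `M`. By convexity the average stays in the ball of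
the norm at the base point, and by concavity of the logarithm the logarithmic means increase, so
that the average is admissible for `E`.
-/

open ProbabilityTheory
open Filter Topology

namespace LatticeInterp

/-! ### Logarithmic integrals -/

lemma logIntegral_mono {g h : 𝕋 → ℝ} (hgh : ∀ᵐ γ ∂m, g γ ≤ h γ) :
    logIntegral g ≤ logIntegral h := by
  refine EReal.sub_le_sub ?_ ?_
  · refine EReal.coe_ennreal_le_coe_ennreal_iff.2 (lintegral_mono_ae ?_)
    filter_upwards [hgh] with γ hγ
    exact EReal.toENNReal_le_toENNReal (ENNReal.log_monotone (ENNReal.ofReal_le_ofReal hγ))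
  · refine EReal.coe_ennreal_le_coe_ennreal_iff.2 (lintegral_mono_ae ?_)
    filter_upwards [hgh] with γ hγ
    exact EReal.toENNReal_le_toENNReal
      (EReal.neg_le_neg_iff.2 (ENNReal.log_monotone (ENNReal.ofReal_le_ofReal hγ)))

lemma logIntegral_zero : logIntegral (fun _ => 0) = ⊥ := by
  simp [logIntegral]

lemma integrable_of_ae_bounds {v : 𝕋 → ℝ} (hv : AEMeasurable v m) {a C : ℝ}
    (h : ∀ᵐ γ ∂m, a ≤ v γ ∧ v γ ≤ C) : Integrable v m := by
  refine Integrable.of_bound hv.aestronglyMeasurable (max |a| |C|) ?_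
  filter_upwards [h] with γ hγ
  exact abs_le_max_abs_abs hγ.1 hγ.2

lemma ae_log_bounds {g : 𝕋 → ℝ} {a C : ℝ} (ha : 0 < a) (h : ∀ᵐ γ ∂m, a ≤ g γ ∧ g γ ≤ C) :
    ∀ᵐ γ ∂m, Real.log a ≤ Real.log (g γ) ∧ Real.log (g γ) ≤ Real.log C := by
  filter_upwards [h] with γ hγ
  exact ⟨Real.log_le_log ha hγ.1, Real.log_le_log (ha.trans_le hγ.1) hγ.2⟩

/-- For functions bounded away from `0` and `∞`, the extended logarithmic integral is an ordinary
Bochner integral. -/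
lemma logIntegral_eq_integral {g : 𝕋 → ℝ} (hg : AEMeasurable g m) {a C : ℝ} (ha : 0 < a)
    (h : ∀ᵐ γ ∂m, a ≤ g γ ∧ g γ ≤ C) :
    logIntegral g = ((∫ γ, Real.log (g γ) ∂m : ℝ) : EReal) := by
  have hint : Integrable (fun γ => Real.log (g γ)) m :=
    integrable_of_ae_bounds (Real.measurable_log.comp_aemeasurable hg) (ae_log_bounds ha h)
  have hlog : ∀ᵐ γ ∂m, ENNReal.log (ENNReal.ofReal (g γ)) = (Real.log (g γ) : EReal) := by
    filter_upwards [h] with γ hγ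
    rw [ENNReal.log_ofReal, if_neg (not_le.2 (ha.trans_le hγ.1))]
  have h1 : ∫⁻ γ, (ENNReal.log (ENNReal.ofReal (g γ))).toENNReal ∂m
      = ∫⁻ γ, ENNReal.ofReal (Real.log (g γ)) ∂m := by
    refine lintegral_congr_ae ?_
    filter_upwards [hlog] with γ hγ
    rw [hγ, EReal.toENNReal_of_ne_top (EReal.coe_ne_top _), EReal.toReal_coe]
  have h2 : ∫⁻ γ, (-ENNReal.log (ENNReal.ofReal (g γ))).toENNReal ∂m
      = ∫⁻ γ, ENNReal.ofReal (-Real.log (g γ)) ∂m := by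
    refine lintegral_congr_ae ?_
    filter_upwards [hlog] with γ hγ
    rw [hγ, ← EReal.coe_neg, EReal.toENNReal_of_ne_top (EReal.coe_ne_top _), EReal.toReal_coe]
  rw [logIntegral, h1, h2, integral_eq_lintegral_pos_part_sub_lintegral_neg_part hint,
    EReal.coe_sub, EReal.coe_ennreal_toReal, EReal.coe_ennreal_toReal]
  · exact hint.neg.lintegral_lt_top.ne
  · exact hint.lintegral_lt_top.ne

lemma logIntegral_const {R : ℝ} (hR : 0 ≤ R) :
    logIntegral (fun _ => R) = ENNReal.log (ENNReal.ofReal R) := by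
  rcases hR.eq_or_lt with rfl | hR
  · simp [logIntegral_zero]
  · rw [logIntegral_eq_integral aemeasurable_const hR (C := R) (by simp), ENNReal.log_ofReal,
      if_neg hR.not_ge]
    simp

lemma logIntegral_comp {M : 𝕋 → 𝕋} (hM : MeasurePreserving M m m) {g : 𝕋 → ℝ}
    (hg : AEMeasurable g m) : logIntegral (fun γ => g (M γ)) = logIntegral g := by
  have key : ∀ F : ℝ → ℝ≥0∞, Measurable F → ∫⁻ γ, F (g (M γ)) ∂m = ∫⁻ γ, F (g γ) ∂m := by
    intro F hF
    have := lintegral_map' (μ := m) (f := fun γ => F (g γ)) (g := M)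
      (by rw [hM.map_eq]; exact hF.comp_aemeasurable hg) hM.aemeasurable
    rw [hM.map_eq] at this
    exact this.symm
  have hlog : Measurable fun r : ℝ => ENNReal.log (ENNReal.ofReal r) :=
    ENNReal.measurable_log.comp ENNReal.measurable_ofReal
  rw [logIntegral, logIntegral, key (fun r => (ENNReal.log (ENNReal.ofReal r)).toENNReal)
      (EReal.continuous_toENNReal.measurable.comp hlog),
    key (fun r => (-ENNReal.log (ENNReal.ofReal r)).toENNReal)
      (EReal.continuous_toENNReal.measurable.comp hlog.neg)]

/-- Continuity of the logarithmic integral from above, along `g + ε` with `ε → 0`. -/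
lemma le_logIntegral_of_forall_add {g : 𝕋 → ℝ} (hg : AEMeasurable g m) {C : ℝ}
    (h : ∀ᵐ γ ∂m, g γ ≤ C) {y : EReal}
    (hy : ∀ ε : ℝ, 0 < ε → y ≤ logIntegral (fun γ => g γ + ε)) : y ≤ logIntegral g := by
  let L : ℝ → EReal := fun r => ENNReal.log (ENNReal.ofReal r)
  have hLc : Continuous L := ENNReal.continuous_log.comp ENNReal.continuous_ofReal
  have hLm : Monotone L := ENNReal.log_monotone.comp ENNReal.ofReal_mono
  let ε : ℕ → ℝ := fun n => 1 / ((n : ℝ) + 1)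
  have hε : ∀ n, 0 < ε n := fun n => Nat.one_div_pos_of_nat
  have hεa : Antitone ε := fun i j hij => Nat.one_div_le_one_div hij
  have hεt : Tendsto ε atTop (𝓝 0) := tendsto_one_div_add_atTop_nhds_zero_nat
  have hLt : ∀ γ, Tendsto (fun n => L (g γ + ε n)) atTop (𝓝 (L (g γ))) := by
    intro γ
    have := (hLc.tendsto (g γ + 0)).comp (tendsto_const_nhds.add hεt)
    simpa [Function.comp_def] using this
  have hpos : Tendsto (fun n => ∫⁻ γ, (L (g γ + ε n)).toENNReal ∂m) atTop
      (𝓝 (∫⁻ γ, (L (g γ)).toENNReal ∂m)) := by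
    refine lintegral_tendsto_of_tendsto_of_antitone ?_ ?_ ?_ ?_
    · exact fun n => (EReal.continuous_toENNReal.measurable.comp hLc.measurable).comp_aemeasurable
        (hg.add_const _)
    · exact .of_forall fun γ i j hij =>
        EReal.toENNReal_le_toENNReal (hLm (by have := hεa hij; linarith))
    · refine ne_top_of_le_ne_top (b := ∫⁻ _, (L (max C 0 + ε 0)).toENNReal ∂m) ?_
        (lintegral_mono_ae ?_)
      · rw [lintegral_const]
        have : L (max C 0 + ε 0) ≠ ⊤ := by
          simp only [L, Ne, ENNReal.log_eq_top_iff]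
          exact ENNReal.ofReal_ne_top
        simpa using this
      · filter_upwards [h] with γ hγ
        exact EReal.toENNReal_le_toENNReal (hLm (by have := le_max_left C 0; linarith))
    · exact .of_forall fun γ => (EReal.continuous_toENNReal.tendsto _).comp (hLt γ)
  have hneg : Tendsto (fun n => ∫⁻ γ, (-L (g γ + ε n)).toENNReal ∂m) atTop
      (𝓝 (∫⁻ γ, (-L (g γ)).toENNReal ∂m)) := by
    refine lintegral_tendsto_of_tendsto_of_monotone ?_ ?_ ?_
    · exact fun n => (EReal.continuous_toENNReal.measurable.comp hLc.measurable.neg).comp_aemeasurable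
        (hg.add_const _)
    · exact .of_forall fun γ i j hij => EReal.toENNReal_le_toENNReal
        (EReal.neg_le_neg_iff.2 (hLm (by have := hεa hij; linarith)))
    · exact .of_forall fun γ => (EReal.continuous_toENNReal.tendsto _).comp
        ((continuous_neg.tendsto _).comp (hLt γ))
  have hfin : ∫⁻ γ, (L (g γ)).toENNReal ∂m ≠ ⊤ := by
    refine ne_top_of_le_ne_top (b := ∫⁻ _, (L C).toENNReal ∂m) ?_ (lintegral_mono_ae ?_)
    · rw [lintegral_const]
      have : L C ≠ ⊤ := by
        simp only [L, Ne, ENNReal.log_eq_top_iff]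
        exact ENNReal.ofReal_ne_top
      simpa using this
    · filter_upwards [h] with γ hγ
      exact EReal.toENNReal_le_toENNReal (hLm hγ)
  have hlim : Tendsto (fun n => logIntegral (fun γ => g γ + ε n)) atTop (𝓝 (logIntegral g)) := by
    have h1 := (continuous_coe_ennreal_ereal.tendsto _).comp hpos
    have h2 := (continuous_neg.tendsto _).comp
      ((continuous_coe_ennreal_ereal.tendsto _).comp hneg)
    refine (EReal.continuousAt_add (.inl ?_) (.inl ?_)).tendsto.comp (h1.prodMk_nhds h2)
    · simpa using hfin
    · simp
  exact ge_of_tendsto' hlim fun n => hy _ (hε n)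

/-! ### Analytic polynomials on the circle -/

/-- The scalar functions of the Hardy space `H¹`: integrable, with vanishing Fourier coefficients
of negative index. -/
def IsHardy (g : 𝕋 → ℂ) : Prop :=
  Integrable g m ∧ ∀ n : ℤ, n < 0 → fourierCoeff g n = 0

lemma isHardy_one : IsHardy fun _ => 1 := by
  refine ⟨integrable_const _, fun n hn => ?_⟩
  have h := congrFun (fourierCoeff_fourier (T := 1) 0) n
  rw [Pi.single_eq_of_ne hn.ne] at h
  rw [← h]
  congr 1
  funext γ
  exact fourier_zero.symm

lemma fourier_one_pow (n : ℕ) (γ : 𝕋) : (fourier 1 γ : ℂ) ^ n = fourier (n : ℤ) γ := by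
  simp [fourier_apply, AddCircle.toCircle_nsmul]

lemma continuous_eval_fourier_one (P : Polynomial ℂ) :
    Continuous fun γ : 𝕋 => P.eval (fourier 1 γ) :=
  P.continuous.comp (fourier 1).continuous

lemma exists_norm_eval_fourier_one_le (P : Polynomial ℂ) :
    ∃ B : ℝ, 0 ≤ B ∧ ∀ γ : 𝕋, ‖P.eval (fourier 1 γ)‖ ≤ B := by
  obtain ⟨B, hB⟩ := isCompact_univ.exists_bound_of_continuousOn
    (continuous_eval_fourier_one P).continuousOn
  exact ⟨B, (norm_nonneg _).trans (hB 0 trivial), fun γ => hB γ trivial⟩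

lemma IsHardy.integrable_mul_eval {g : 𝕋 → ℂ} (hg : IsHardy g) (P : Polynomial ℂ) :
    Integrable (fun γ => P.eval (fourier 1 γ) * g γ) m := by
  obtain ⟨B, -, hB⟩ := exists_norm_eval_fourier_one_le P
  exact hg.1.bdd_mul (continuous_eval_fourier_one P).aestronglyMeasurable (.of_forall hB)

/-- The mean over the circle is multiplicative on products of an `H¹` function and an analytic
polynomial. -/
lemma IsHardy.integral_eval_mul {g : 𝕋 → ℂ} (hg : IsHardy g) (P : Polynomial ℂ) :
    ∫ γ, P.eval (fourier 1 γ) * g γ ∂m = P.eval 0 * ∫ γ, g γ ∂m := by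
  induction P using Polynomial.induction_on' with
  | add p q hp hq =>
    simp only [Polynomial.eval_add, add_mul]
    rw [integral_add (hg.integrable_mul_eval p) (hg.integrable_mul_eval q), hp, hq]
  | monomial n a =>
    rcases Nat.eq_zero_or_pos n with rfl | hn
    · simp [integral_const_mul]
    · have h := hg.2 (-n) (by omega)
      simp only [fourierCoeff, neg_neg, smul_eq_mul] at h
      simp only [Polynomial.eval_monomial, fourier_one_pow, mul_assoc, integral_const_mul, h]
      simp [hn.ne']

/-- The mean over the circle is multiplicative on products of an `H¹` function and the exponential
of an analytic polynomial. -/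
lemma IsHardy.integral_exp_mul {g : 𝕋 → ℂ} (hg : IsHardy g) (Q : Polynomial ℂ) :
    ∫ γ, Complex.exp (Q.eval (fourier 1 γ)) * g γ ∂m = Complex.exp (Q.eval 0) * ∫ γ, g γ ∂m := by
  obtain ⟨B, hB0, hB⟩ := exists_norm_eval_fourier_one_le Q
  have hexp : ∀ z : ℂ, HasSum (fun n : ℕ => z ^ n / n.factorial) (Complex.exp z) := fun z => by
    rw [Complex.exp_eq_exp_ℂ]
    exact NormedSpace.expSeries_div_hasSum_exp z
  have hexpB : HasSum (fun n : ℕ => B ^ n / n.factorial) (Real.exp B) := by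
    rw [Real.exp_eq_exp_ℝ]
    exact NormedSpace.expSeries_div_hasSum_exp B
  have hsum : ∀ γ, HasSum (fun n : ℕ => B ^ n / n.factorial * ‖g γ‖) (Real.exp B * ‖g γ‖) :=
    fun γ => hexpB.mul_right _
  have h1 : HasSum (fun n : ℕ => ∫ γ, Q.eval (fourier 1 γ) ^ n / n.factorial * g γ ∂m)
      (∫ γ, Complex.exp (Q.eval (fourier 1 γ)) * g γ ∂m) := by
    refine hasSum_integral_of_dominated_convergence
      (fun n γ => B ^ n / n.factorial * ‖g γ‖) ?_ ?_ ?_ ?_ ?_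
    · exact fun n => ((((continuous_eval_fourier_one Q).pow n).div_const _).aestronglyMeasurable).mul
        hg.1.aestronglyMeasurable
    · refine fun n => .of_forall fun γ => ?_
      rw [norm_mul, norm_div, norm_pow, Complex.norm_natCast]
      gcongr
      exact hB γ
    · exact .of_forall fun γ => (hsum γ).summable
    · simp only [fun γ => (hsum γ).tsum_eq]
      exact hg.1.norm.const_mul _
    · exact .of_forall fun γ => (hexp _).mul_right _
  have h2 : ∀ n : ℕ, ∫ γ, Q.eval (fourier 1 γ) ^ n / n.factorial * g γ ∂m
      = Q.eval 0 ^ n / n.factorial * ∫ γ, g γ ∂m := by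
    intro n
    have h := hg.integral_eval_mul (Polynomial.C ((n.factorial : ℂ)⁻¹) * Q ^ n)
    simp only [Polynomial.eval_mul, Polynomial.eval_C, Polynomial.eval_pow] at h
    simpa only [div_eq_inv_mul] using h
  simp only [h2] at h1
  exact h1.unique ((hexp _).mul_right _)

/-- The boundary values of an analytic polynomial that is real at the origin are dominated in `L²`
by their real part: `∫ q² = q(0)² ≥ 0`, so that `∫ (Im q)² ≤ ∫ (Re q)²`. -/
lemma eLpNorm_eval_le (Q : Polynomial ℂ) (hQ : (Q.eval 0).im = 0) :
    eLpNorm (fun γ : 𝕋 => Q.eval (fourier 1 γ)) 2 m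
      ≤ 2 * eLpNorm (fun γ : 𝕋 => (Q.eval (fourier 1 γ)).re) 2 m := by
  set q : 𝕋 → ℂ := fun γ => Q.eval (fourier 1 γ) with hq
  have hqc : Continuous q := continuous_eval_fourier_one Q
  have hre : Continuous fun γ => (q γ).re := Complex.continuous_re.comp hqc
  have him : Continuous fun γ => (q γ).im := Complex.continuous_im.comp hqc
  have hint : ∀ f : 𝕋 → ℝ, Continuous f → Integrable f m := fun f hf =>
    hf.integrable_of_hasCompactSupport (HasCompactSupport.of_compactSpace f)
  have hmem : ∀ f : 𝕋 → ℝ, Continuous f → MemLp f 2 m := fun f hf =>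
    hf.memLp_of_hasCompactSupport (HasCompactSupport.of_compactSpace f)
  have hsq : ∫ γ, (q γ).im ^ 2 ∂m ≤ ∫ γ, (q γ).re ^ 2 ∂m := by
    have h := isHardy_one.integral_eval_mul (Q ^ 2)
    simp only [Polynomial.eval_pow, mul_one] at h
    have hr := congrArg Complex.re h
    have hi : Integrable (fun γ => q γ ^ 2) m :=
      (hqc.pow 2).integrable_of_hasCompactSupport (HasCompactSupport.of_compactSpace _)
    have h3 : (∫ γ, q γ ^ 2 ∂m).re = ∫ γ, (q γ ^ 2).re ∂m := (integral_re hi).symm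
    rw [h3] at hr
    have h4 : ∫ γ, (q γ ^ 2).re ∂m = ∫ γ, (q γ).re ^ 2 ∂m - ∫ γ, (q γ).im ^ 2 ∂m := by
      rw [← integral_sub (hint (fun γ => (q γ).re ^ 2) (hre.pow 2))
        (hint (fun γ => (q γ).im ^ 2) (him.pow 2))]
      refine integral_congr_ae (.of_forall fun γ => ?_)
      simp [sq, Complex.mul_re]
    have h5 : 0 ≤ (Q.eval 0 ^ 2 * ∫ _ : 𝕋, (1 : ℂ) ∂m).re := by
      simp [sq, Complex.mul_re, hQ, mul_self_nonneg]
    linarith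
  have him_le : eLpNorm (fun γ => (q γ).im) 2 m ≤ eLpNorm (fun γ => (q γ).re) 2 m := by
    rw [(hmem _ him).eLpNorm_eq_integral_rpow_norm two_ne_zero ENNReal.ofNat_ne_top,
      (hmem _ hre).eLpNorm_eq_integral_rpow_norm two_ne_zero ENNReal.ofNat_ne_top]
    refine ENNReal.ofReal_le_ofReal ?_
    have hnn : 0 ≤ ∫ γ, (q γ).im ^ 2 ∂m := integral_nonneg fun γ => sq_nonneg _
    simpa using Real.rpow_le_rpow hnn hsq (by norm_num : (0 : ℝ) ≤ 2⁻¹)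
  have hsum : q = (fun γ => ((q γ).re : ℂ)) + fun γ => ((q γ).im : ℂ) * Complex.I := by
    funext γ
    simp
  have e1 : eLpNorm (fun γ => ((q γ).re : ℂ)) 2 m = eLpNorm (fun γ => (q γ).re) 2 m :=
    eLpNorm_congr_norm_ae (.of_forall fun γ => by simp)
  have e2 : eLpNorm (fun γ => ((q γ).im : ℂ) * Complex.I) 2 m = eLpNorm (fun γ => (q γ).im) 2 m :=
    eLpNorm_congr_norm_ae (.of_forall fun γ => by simp)
  calc eLpNorm q 2 m ≤ _ + _ := by
        conv_lhs => rw [hsum]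
        exact eLpNorm_add_le (Complex.continuous_ofReal.comp hre).aestronglyMeasurable
          ((Complex.continuous_ofReal.comp him).mul continuous_const).aestronglyMeasurable
          one_le_two
    _ ≤ 2 * eLpNorm (fun γ => (q γ).re) 2 m := by
        rw [e1, e2, two_mul]
        gcongr

lemma exists_eval_add_conj_eval {p : C(𝕋, ℂ)}
    (hp : p ∈ Submodule.span ℂ (Set.range (fourier (T := 1)))) :
    ∃ Q₁ Q₂ : Polynomial ℂ, ∀ γ, p γ = Q₁.eval (fourier 1 γ)
      + (starRingEnd ℂ) (Q₂.eval (fourier 1 γ)) := by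
  induction hp using Submodule.span_induction with
  | mem x hx =>
    obtain ⟨n, rfl⟩ := hx
    obtain ⟨k, rfl | rfl⟩ := n.eq_nat_or_neg
    · exact ⟨Polynomial.X ^ k, 0, fun γ => by simp [-fourier_apply, fourier_one_pow]⟩
    · exact ⟨0, Polynomial.X ^ k, fun γ => by
        rw [Polynomial.eval_pow, Polynomial.eval_X, fourier_one_pow, fourier_neg]; simp⟩
  | zero => exact ⟨0, 0, by simp⟩
  | add x y _ _ hx hy =>
    obtain ⟨P₁, P₂, hP⟩ := hx
    obtain ⟨R₁, R₂, hR⟩ := hy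
    refine ⟨P₁ + R₁, P₂ + R₂, fun γ => ?_⟩
    rw [ContinuousMap.add_apply, hP, hR, Polynomial.eval_add, Polynomial.eval_add, map_add]
    ring
  | smul a x _ hx =>
    obtain ⟨P₁, P₂, hP⟩ := hx
    refine ⟨Polynomial.C a * P₁, Polynomial.C ((starRingEnd ℂ) a) * P₂, fun γ => ?_⟩
    rw [ContinuousMap.smul_apply, hP]
    simp only [Polynomial.eval_mul, Polynomial.eval_C, map_mul, Complex.conj_conj, smul_eq_mul]
    ring

/-- The real parts of the analytic polynomials that are real at the origin are uniformly dense in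
the real continuous functions. -/
lemma exists_polynomial_re_near (h : C(𝕋, ℝ)) {δ : ℝ} (hδ : 0 < δ) :
    ∃ Q : Polynomial ℂ, (Q.eval 0).im = 0 ∧
      ∀ γ : 𝕋, |(Q.eval (fourier 1 γ)).re - h γ| ≤ δ := by
  let hc : C(𝕋, ℂ) := ⟨fun γ => (h γ : ℂ), Complex.continuous_ofReal.comp h.continuous⟩
  have hmem : hc ∈ (Submodule.span ℂ (Set.range (fourier (T := 1)))).topologicalClosure := by
    rw [span_fourier_closure_eq_top]
    trivial
  obtain ⟨p, hp, hdist⟩ := Metric.mem_closure_iff.1 hmem δ hδ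
  obtain ⟨Q₁, Q₂, hQ⟩ := exists_eval_add_conj_eval hp
  -- an imaginary constant makes the polynomial real at the origin without changing its real part
  refine ⟨Q₁ + Q₂ - Polynomial.C ((((Q₁ + Q₂).eval 0).im : ℂ) * Complex.I), by simp, fun γ => ?_⟩
  have h1 : (p γ).re = ((Q₁ + Q₂ - Polynomial.C ((((Q₁ + Q₂).eval 0).im : ℂ)
      * Complex.I)).eval (fourier 1 γ)).re := by
    rw [hQ]
    simp [-fourier_apply]
  have h2 : ‖(p - hc) γ‖ ≤ ‖p - hc‖ := ContinuousMap.norm_coe_le_norm _ _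
  rw [dist_comm, dist_eq_norm] at hdist
  rw [← h1]
  calc |(p γ).re - h γ| = |((p - hc) γ).re| := by simp [hc]
    _ ≤ ‖(p - hc) γ‖ := Complex.abs_re_le_norm _
    _ ≤ δ := h2.trans hdist.le

/-- A bounded real function is the `L²` limit of uniformly bounded real parts of analytic
polynomials. -/
lemma exists_polynomial_eLpNorm_le {v : 𝕋 → ℝ} (hv : AEMeasurable v m) {B : ℝ} (hB0 : 0 ≤ B)
    (hB : ∀ᵐ γ ∂m, |v γ| ≤ B) {δ : ℝ} (hδ : 0 < δ) :
    ∃ Q : Polynomial ℂ, (Q.eval 0).im = 0 ∧ (∀ γ : 𝕋, |(Q.eval (fourier 1 γ)).re| ≤ B + δ) ∧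
      eLpNorm (fun γ => (Q.eval (fourier 1 γ)).re - v γ) 2 m ≤ ENNReal.ofReal (2 * δ) := by
  have hvL : MemLp v 2 m := MemLp.of_bound hv.aestronglyMeasurable B hB
  obtain ⟨g, hg, -⟩ := hvL.exists_boundedContinuous_eLpNorm_sub_le ENNReal.ofNat_ne_top
    (ε := ENNReal.ofReal δ) (by simpa using hδ)
  let h : C(𝕋, ℝ) := ⟨fun γ => max (-B) (min B (g γ)),
    continuous_const.max (continuous_const.min g.continuous)⟩
  have hhB : ∀ γ, |h γ| ≤ B := fun γ =>
    abs_le.2 ⟨le_max_left _ _, max_le (by linarith) (min_le_left _ _)⟩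
  have hhv : eLpNorm (fun γ => h γ - v γ) 2 m ≤ ENNReal.ofReal δ := by
    refine le_trans (eLpNorm_mono_ae ?_) hg
    filter_upwards [hB] with γ hγ
    have hγ' := abs_le.1 hγ
    have hcl : v γ = max (-B) (min B (v γ)) := by
      rw [min_eq_right hγ'.2, max_eq_right hγ'.1]
    rw [Real.norm_eq_abs, Real.norm_eq_abs, Pi.sub_apply, abs_sub_comm (v γ)]
    calc |h γ - v γ| = |max (-B) (min B (g γ)) - max (-B) (min B (v γ))| := by rw [← hcl]; rfl
      _ ≤ |min B (g γ) - min B (v γ)| := by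
        simpa using abs_max_sub_max_le_max (-B) (min B (g γ)) (-B) (min B (v γ))
      _ ≤ |g γ - v γ| := by
        simpa using abs_min_sub_min_le_max B (g γ) B (v γ)
  obtain ⟨Q, hQ0, hQ⟩ := exists_polynomial_re_near h hδ
  refine ⟨Q, hQ0, fun γ => ?_, ?_⟩
  · have := abs_sub_abs_le_abs_sub (Q.eval (fourier 1 γ)).re (h γ)
    linarith [hQ γ, hhB γ]
  · have hQc := Complex.continuous_re.comp (continuous_eval_fourier_one Q)
    have hsum : (fun γ => (Q.eval (fourier 1 γ)).re - v γ)
        = (fun γ => (Q.eval (fourier 1 γ)).re - h γ) + fun γ => h γ - v γ := by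
      funext γ
      simp
    have h1 : eLpNorm (fun γ => (Q.eval (fourier 1 γ)).re - h γ) 2 m ≤ ENNReal.ofReal δ := by
      refine (eLpNorm_le_of_ae_bound (C := δ) (.of_forall hQ)).trans ?_
      simp
    rw [hsum, two_mul, ENNReal.ofReal_add hδ.le hδ.le]
    exact (eLpNorm_add_le (hQc.sub h.continuous).aestronglyMeasurable
      (h.continuous.aestronglyMeasurable.sub hv.aestronglyMeasurable) one_le_two).trans
      (add_le_add h1 hhv)

/-! ### Outer functions and Jensen's inequality -/

/-- Bounded outer functions. For a bounded real function `v` there is `G` with `|G| = exp v` whose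
value at the origin is `exp (∫ v)`; analyticity of `G` and its value at the origin are expressed by
multiplicativity of the mean against `H¹`. The function is the limit of the exponentials of
analytic polynomials whose real parts approximate `v`. -/
lemma exists_outer {v : 𝕋 → ℝ} (hv : AEMeasurable v m) {B : ℝ} (hB : ∀ᵐ γ ∂m, |v γ| ≤ B) :
    ∃ G : 𝕋 → ℂ, StronglyMeasurable G ∧ (∀ᵐ γ ∂m, ‖G γ‖ = Real.exp (v γ)) ∧
      ∀ g : 𝕋 → ℂ, IsHardy g →
        ∫ γ, G γ * g γ ∂m = (Real.exp (∫ γ, v γ ∂m) : ℂ) * ∫ γ, g γ ∂m := by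
  have hB0 : 0 ≤ B := by
    obtain ⟨γ, hγ⟩ := hB.exists
    exact (abs_nonneg _).trans hγ
  let δ : ℕ → ℝ := fun n => (1 / 2) ^ n
  have hδ : ∀ n, 0 < δ n := fun n => by positivity
  have hδ1 : ∀ n, δ n ≤ 1 := fun n => pow_le_one₀ (by norm_num) (by norm_num)
  have hδa : Antitone δ := pow_right_anti₀ (by norm_num) (by norm_num)
  have hδs : Summable δ := summable_geometric_two
  choose Q hQ0 hQB hQv using fun n => exists_polynomial_eLpNorm_le hv hB0 hB (hδ n)
  let q : ℕ → 𝕋 → ℂ := fun n γ => (Q n).eval (fourier 1 γ)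
  have hqc : ∀ n, Continuous (q n) := fun n => continuous_eval_fourier_one (Q n)
  have hrem : ∀ n, AEStronglyMeasurable (fun γ => (q n γ).re) m := fun n =>
    (Complex.continuous_re.comp (hqc n)).aestronglyMeasurable
  -- control of the real parts in `L²` gives almost everywhere convergence of the polynomials
  have hcauchy : ∀ᵐ γ ∂m, ∃ l, Tendsto (fun n => q n γ) atTop (𝓝 l) := by
    refine Lp.ae_tendsto_of_cauchy_eLpNorm (p := 2) (fun n => (hqc n).aestronglyMeasurable)
      one_le_two (B := fun n => ENNReal.ofReal (9 * δ n)) ?_ ?_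
    · exact (hδs.mul_left 9).tsum_ofReal_ne_top
    · intro N i j hi hj
      have h0 : ((Q i - Q j).eval 0).im = 0 := by
        rw [Polynomial.eval_sub, Complex.sub_im, hQ0, hQ0, sub_zero]
      have h1 := eLpNorm_eval_le (Q i - Q j) h0
      have h2 : (fun γ : 𝕋 => ((Q i - Q j).eval (fourier 1 γ)).re)
          = (fun γ => (q i γ).re - v γ) - fun γ => (q j γ).re - v γ := by
        funext γ
        simp [q, -fourier_apply]
      have h3 : eLpNorm ((fun γ => (q i γ).re - v γ) - fun γ => (q j γ).re - v γ) 2 m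
          ≤ ENNReal.ofReal (2 * δ i) + ENNReal.ofReal (2 * δ j) :=
        (eLpNorm_sub_le ((hrem i).sub hv.aestronglyMeasurable)
          ((hrem j).sub hv.aestronglyMeasurable) one_le_two).trans (add_le_add (hQv i) (hQv j))
      have h4 : q i - q j = fun γ : 𝕋 => (Q i - Q j).eval (fourier 1 γ) := by
        funext γ
        simp [q, -fourier_apply]
      rw [h4]
      rw [h2] at h1
      refine (h1.trans (mul_le_mul_right h3 2)).trans_lt ?_
      rw [← ENNReal.ofReal_add (by have := hδ i; positivity) (by have := hδ j; positivity),
        show (2 : ℝ≥0∞) = ENNReal.ofReal 2 by simp, ← ENNReal.ofReal_mul (by norm_num)]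
      refine (ENNReal.ofReal_lt_ofReal_iff (by have := hδ N; positivity)).2 ?_
      have := hδa hi
      have := hδa hj
      have := hδ N
      linarith
  obtain ⟨l, hlm, hl⟩ :=
    exists_stronglyMeasurable_limit_of_tendsto_ae (fun n => (hqc n).aestronglyMeasurable) hcauchy
  have hre : ∀ᵐ γ ∂m, (l γ).re = v γ := by
    have hmeas : TendstoInMeasure m (fun n γ => (q n γ).re) atTop v := by
      refine tendstoInMeasure_of_tendsto_eLpNorm two_ne_zero hrem hv.aestronglyMeasurable ?_
      refine tendsto_of_tendsto_of_tendsto_of_le_of_le tendsto_const_nhds ?_ (fun _ => bot_le)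
        hQv
      have : Tendsto (fun n => 2 * δ n) atTop (𝓝 (2 * 0)) :=
        hδs.tendsto_atTop_zero.const_mul 2
      simpa using ENNReal.tendsto_ofReal this
    obtain ⟨ns, hns, hlim⟩ := hmeas.exists_seq_tendsto_ae
    filter_upwards [hl, hlim] with γ h1 h2
    exact tendsto_nhds_unique
      (((Complex.continuous_re.tendsto _).comp h1).comp hns.tendsto_atTop) h2
  have hbound : ∀ n γ, ‖Complex.exp (q n γ)‖ ≤ Real.exp (B + 1) := fun n γ => by
    rw [Complex.norm_exp]
    exact Real.exp_le_exp.2 ((le_abs_self _).trans ((hQB n γ).trans (by linarith [hδ1 n])))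
  have hvalue : Tendsto (fun n => Complex.exp ((Q n).eval 0)) atTop
      (𝓝 (Real.exp (∫ γ, v γ ∂m) : ℂ)) := by
    have h1 : ∀ n, (Q n).eval 0 = ((∫ γ, (q n γ).re ∂m : ℝ) : ℂ) := by
      intro n
      have h := isHardy_one.integral_eval_mul (Q n)
      simp only [mul_one, integral_const, probReal_univ, one_smul] at h
      have hi : Integrable (q n) m :=
        (hqc n).integrable_of_hasCompactSupport (HasCompactSupport.of_compactSpace _)
      have h3 : ∫ γ, (q n γ).re ∂m = (∫ γ, q n γ ∂m).re := integral_re hi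
      rw [h3, h]
      exact Complex.ext rfl (by simp [hQ0])
    have h2 : Tendsto (fun n => ∫ γ, (q n γ).re ∂m) atTop (𝓝 (∫ γ, v γ ∂m)) := by
      refine tendsto_integral_of_dominated_convergence (fun _ => B + 1) hrem
        (integrable_const _) ?_ ?_
      · refine fun n => .of_forall fun γ => ?_
        exact (hQB n γ).trans (by linarith [hδ1 n])
      · filter_upwards [hl, hre] with γ hγ hγ'
        rw [← hγ']
        exact (Complex.continuous_re.tendsto _).comp hγ
    rw [Complex.ofReal_exp]
    refine (Complex.continuous_exp.tendsto _).comp ?_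
    simp only [h1]
    exact (Complex.continuous_ofReal.tendsto _).comp h2
  refine ⟨fun γ => Complex.exp (l γ), Complex.continuous_exp.comp_stronglyMeasurable hlm, ?_, ?_⟩
  · filter_upwards [hre] with γ hγ
    rw [Complex.norm_exp, hγ]
  · intro g hg
    have h1 : Tendsto (fun n => ∫ γ, Complex.exp (q n γ) * g γ ∂m) atTop
        (𝓝 (∫ γ, Complex.exp (l γ) * g γ ∂m)) := by
      refine tendsto_integral_of_dominated_convergence (fun γ => Real.exp (B + 1) * ‖g γ‖)
        (fun n => (Complex.continuous_exp.comp (hqc n)).aestronglyMeasurable.mul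
          hg.1.aestronglyMeasurable) (hg.1.norm.const_mul _) ?_ ?_
      · refine fun n => .of_forall fun γ => ?_
        rw [norm_mul]
        exact mul_le_mul_of_nonneg_right (hbound n γ) (norm_nonneg _)
      · filter_upwards [hl] with γ hγ
        exact ((Complex.continuous_exp.tendsto _).comp hγ).mul_const _
    have h2 : ∀ n, ∫ γ, Complex.exp (q n γ) * g γ ∂m
        = Complex.exp ((Q n).eval 0) * ∫ γ, g γ ∂m := fun n => hg.integral_exp_mul (Q n)
    simp only [h2] at h1
    exact tendsto_nhds_unique h1 (hvalue.mul_const _)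

/-- Jensen's inequality for bounded functions of the Hardy space: multiplication by the outer
function of modulus `1 / (|g| + ε)` reduces it to the maximum principle `|∫ G g| ≤ 1`. -/
lemma IsHardy.log_norm_integral_le {g : 𝕋 → ℂ} (hg : IsHardy g) {C : ℝ}
    (hC : ∀ᵐ γ ∂m, ‖g γ‖ ≤ C) :
    ENNReal.log (ENNReal.ofReal ‖∫ γ, g γ ∂m‖) ≤ logIntegral fun γ => ‖g γ‖ := by
  have hgm : AEMeasurable (fun γ => ‖g γ‖) m := hg.1.aestronglyMeasurable.norm.aemeasurable
  refine le_logIntegral_of_forall_add hgm hC fun ε hε => ?_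
  have hb : ∀ᵐ γ ∂m, ε ≤ ‖g γ‖ + ε ∧ ‖g γ‖ + ε ≤ C + ε := by
    filter_upwards [hC] with γ hγ
    exact ⟨by linarith [norm_nonneg (g γ)], by linarith⟩
  rw [logIntegral_eq_integral (hgm.add_const ε) hε hb]
  have hvm : AEMeasurable (fun γ => -Real.log (‖g γ‖ + ε)) m :=
    (Real.measurable_log.comp_aemeasurable (hgm.add_const ε)).neg
  obtain ⟨G, -, hGn, hG⟩ := exists_outer hvm (B := max |Real.log ε| |Real.log (C + ε)|) (by
    filter_upwards [ae_log_bounds hε hb] with γ hγ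
    rw [abs_neg]
    exact abs_le_max_abs_abs hγ.1 hγ.2)
  have h1 : ‖∫ γ, G γ * g γ ∂m‖ ≤ 1 := by
    have := norm_integral_le_of_norm_le_const (μ := m) (f := fun γ => G γ * g γ) (C := 1) (by
      filter_upwards [hGn, hb] with γ h1 h2
      have hpos := hε.trans_le h2.1
      rw [norm_mul, h1, Real.exp_neg, Real.exp_log hpos, inv_mul_le_iff₀ hpos]
      linarith)
    simpa using this
  rw [hG g hg, norm_mul, Complex.norm_real, Real.norm_of_nonneg (Real.exp_nonneg _),
    integral_neg, Real.exp_neg, inv_mul_le_iff₀ (Real.exp_pos _), mul_one] at h1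
  refine (ENNReal.log_monotone (ENNReal.ofReal_le_ofReal h1)).trans ?_
  rw [ENNReal.log_ofReal, if_neg (Real.exp_pos _).not_ge, Real.log_exp]

variable {N : ℕ} {b : Module.Basis (Fin N) ℂ (Fin N → ℂ)} {E : 𝕋 → Seminorm ℂ (Fin N → ℂ)}

/-! ### Families of lattice seminorms -/

/-- A measurable family of seminorms, almost all of them lattice seminorms, with two-sided bounds on
the basis vectors. The bounds are stated with real constants, so that the property passes directly
to the families `γ ↦ E (M γ)` with `M` measure preserving. -/
structure IsRegularLatticeFamily (b : Module.Basis (Fin N) ℂ (Fin N → ℂ))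
    (E : 𝕋 → Seminorm ℂ (Fin N → ℂ)) : Prop where
  measurable : ∀ x, AEMeasurable (fun γ => E γ x) m
  lattice : ∀ᵐ γ ∂m, IsLatticeNorm b (E γ)
  bounds : ∃ c C : Fin N → ℝ, (∀ k, 0 < c k) ∧
    ∀ᵐ γ ∂m, ∀ k, c k ≤ E γ (b k) ∧ E γ (b k) ≤ C k

lemma IsCompatibleLatticeFamily.isRegularLatticeFamily (hE : IsInterpolationFamily E)
    (hL : IsCompatibleLatticeFamily b E) : IsRegularLatticeFamily b E := by
  refine ⟨hE.measurable, hL.lattice,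
    fun k => (essInf (fun γ => ENNReal.ofReal (E γ (b k))) m).toReal,
    fun k => (essSup (fun γ => ENNReal.ofReal (E γ (b k))) m).toReal, fun k => ?_, ?_⟩
  · refine ENNReal.toReal_pos (hL.essInf_pos k).ne' (ne_top_of_le_ne_top (hL.essSup_lt_top k).ne ?_)
    obtain ⟨γ, h1, h2⟩ := ((ae_essInf_le (μ := m) (f := fun γ => ENNReal.ofReal (E γ (b k)))).and
      (ENNReal.ae_le_essSup (μ := m) fun γ => ENNReal.ofReal (E γ (b k)))).exists
    exact h1.trans h2
  · refine ae_all_iff.2 fun k => ?_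
    filter_upwards [ae_essInf_le (μ := m) (f := fun γ => ENNReal.ofReal (E γ (b k))),
      ENNReal.ae_le_essSup (μ := m) fun γ => ENNReal.ofReal (E γ (b k))] with γ h1 h2
    exact ⟨ENNReal.toReal_le_of_le_ofReal (apply_nonneg _ _) h1,
      (ENNReal.ofReal_le_iff_le_toReal (hL.essSup_lt_top k).ne).1 h2⟩

lemma IsRegularLatticeFamily.comp (H : IsRegularLatticeFamily b E) {M : 𝕋 → 𝕋}
    (hM : MeasurePreserving M m m) : IsRegularLatticeFamily b fun γ => E (M γ) := by
  have hq := hM.quasiMeasurePreserving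
  obtain ⟨c, C, hc, hC⟩ := H.bounds
  refine ⟨fun x => (H.measurable x).comp_quasiMeasurePreserving hq, ?_, c, C, hc, ?_⟩
  · exact hq.ae (p := fun γ => IsLatticeNorm b (E γ)) H.lattice
  · exact hq.ae (p := fun γ => ∀ k, c k ≤ E γ (b k) ∧ E γ (b k) ≤ C k) hC

lemma continuous_seminorm (p : Seminorm ℂ (Fin N → ℂ)) : Continuous p := by
  have h := (Seminorm.convexOn p).continuousOn isOpen_univ
  exact continuousOn_univ.1 h

/-- Off a null set, a measurable family of seminorms agrees with one that is jointly measurable in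
the parameter and the vector. -/
lemma exists_measurable_modification (hE : ∀ x, AEMeasurable (fun γ => E γ x) m) :
    ∃ E' : 𝕋 → Seminorm ℂ (Fin N → ℂ),
      Measurable (fun q : (Fin N → ℂ) × 𝕋 => E' q.2 q.1) ∧ ∀ᵐ γ ∂m, E γ = E' γ := by
  classical
  let D := TopologicalSpace.denseSeq (Fin N → ℂ)
  have hae : ∀ᵐ γ ∂m, ∀ n, E γ (D n) = (hE (D n)).mk _ γ :=
    ae_all_iff.2 fun n => (hE (D n)).ae_eq_mk
  let Z := toMeasurable m {γ | ¬ ∀ n, E γ (D n) = (hE (D n)).mk _ γ}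
  have hZ : MeasurableSet Z := measurableSet_toMeasurable _ _
  have hZ0 : m Z = 0 := (measure_toMeasurable _).trans (ae_iff.1 hae)
  have hZmem : ∀ γ, γ ∉ Z → ∀ n, E γ (D n) = (hE (D n)).mk _ γ := fun γ hγ => by
    by_contra h
    exact hγ (subset_toMeasurable _ _ h)
  let E' : 𝕋 → Seminorm ℂ (Fin N → ℂ) := fun γ => if γ ∈ Z then 0 else E γ
  have hD : ∀ n, Measurable fun γ => E' γ (D n) := by
    intro n
    have h : (fun γ => E' γ (D n)) = fun γ => if γ ∈ Z then 0 else (hE (D n)).mk _ γ := by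
      funext γ
      by_cases hγ : γ ∈ Z
      · simp [E', hγ]
      · simp only [E', if_neg hγ, hZmem γ hγ n]
    rw [h]
    exact Measurable.ite hZ measurable_const (hE (D n)).measurable_mk
  refine ⟨E', ?_, ?_⟩
  · have hx : ∀ x, Measurable fun γ => E' γ x := by
      intro x
      obtain ⟨u, hu, hux⟩ := mem_closure_iff_seq_limit.1
        (TopologicalSpace.denseRange_denseSeq (Fin N → ℂ) x)
      refine measurable_of_tendsto_metrizable (f := fun n γ => E' γ (u n)) (fun n => ?_)
        (tendsto_pi_nhds.2 fun γ => ((continuous_seminorm (E' γ)).tendsto x).comp hux)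
      obtain ⟨k, hk⟩ := hu n
      rw [← hk]
      exact hD k
    exact measurable_uncurry_of_continuous_of_measurable (u := fun x γ => E' γ x)
      (fun γ => continuous_seminorm (E' γ)) hx
  · filter_upwards [measure_eq_zero_iff_ae_notMem.1 hZ0] with γ hγ
    exact (if_neg hγ).symm

lemma IsRegularLatticeFamily.aemeasurable_apply (H : IsRegularLatticeFamily b E)
    {f : 𝕋 → Fin N → ℂ} (hf : AEMeasurable f m) : AEMeasurable (fun γ => E γ (f γ)) m := by
  obtain ⟨E', hE', hae⟩ := exists_measurable_modification H.measurable
  refine (hE'.comp_aemeasurable (hf.prodMk aemeasurable_id)).congr ?_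
  filter_upwards [hae] with γ hγ
  simp [hγ]

lemma aemeasurable_repr {f : 𝕋 → Fin N → ℂ} (hf : AEMeasurable f m) (k : Fin N) :
    AEMeasurable (fun γ => b.repr (f γ) k) m :=
  ((b.coord k).continuous_of_finiteDimensional.measurable).comp_aemeasurable hf

lemma IsLatticeNorm.norm_repr_mul_le {p : Seminorm ℂ (Fin N → ℂ)} (hp : IsLatticeNorm b p)
    (y : Fin N → ℂ) (k : Fin N) : ‖b.repr y k‖ * p (b k) ≤ p y := by
  rw [← map_smul_eq_mul]
  refine hp _ _ fun j => ?_
  rw [map_smul, Finsupp.smul_apply, Module.Basis.repr_self, Finsupp.single_apply]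
  split_ifs with h
  · simp [h]
  · simp

lemma seminorm_le_sum (b : Module.Basis (Fin N) ℂ (Fin N → ℂ)) (p : Seminorm ℂ (Fin N → ℂ))
    (y : Fin N → ℂ) : p y ≤ ∑ k, ‖b.repr y k‖ * p (b k) := by
  conv_lhs => rw [← b.sum_repr y]
  refine (Finset.le_sum_of_subadditive p (map_zero p).le (map_add_le_add p) _ _).trans ?_
  simp [map_smul_eq_mul]

lemma repr_sum_smul (b : Module.Basis (Fin N) ℂ (Fin N → ℂ)) (a : Fin N → ℂ) (k : Fin N) :
    b.repr (∑ j, a j • b j) k = a k := by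
  rw [b.repr_sum_self]

/-! ### Analytic functions and their coordinates -/

lemma isHardy_fourier {j : ℤ} (hj : 0 ≤ j) : IsHardy fun γ => fourier j γ := by
  refine ⟨(fourier j).continuous.integrable_of_hasCompactSupport
    (HasCompactSupport.of_compactSpace _), fun n hn => ?_⟩
  have h := congrFun (fourierCoeff_fourier (T := 1) j) n
  rwa [Pi.single_eq_of_ne (by omega)] at h

lemma IsAnalyticOnCircle.isHardy_repr {f : 𝕋 → Fin N → ℂ} (hf : IsAnalyticOnCircle f)
    (b : Module.Basis (Fin N) ℂ (Fin N → ℂ)) (k : Fin N) :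
    IsHardy (fun γ => b.repr (f γ) k) ∧
      ∫ γ, b.repr (f γ) k ∂m = b.repr (fourierCoeff f 0) k := by
  let L : (Fin N → ℂ) →L[ℂ] ℂ := LinearMap.toContinuousLinearMap (b.coord k)
  have hL : ∀ y, L y = b.repr y k := fun y => rfl
  have hcoeff : ∀ n, fourierCoeff (fun γ => L (f γ)) n = L (fourierCoeff f n) := by
    intro n
    rw [fourierCoeff, fourierCoeff, ← L.integral_comp_comm (hf.1.fourier_smul (-n))]
    simp only [map_smul]
  simp only [← hL]
  refine ⟨⟨L.integrable_comp hf.1, fun n hn => by rw [hcoeff, hf.2 n hn, map_zero]⟩, ?_⟩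
  rw [← hcoeff 0]
  simp [fourierCoeff]

/-- If multiplication by `G k` scales the means of `H¹` functions by `a k`, then `∑ k, G k • w k` is
analytic with value `∑ k, a k • w k` at `0`. -/
lemma isAnalyticOnCircle_sum_smul {G : Fin N → 𝕋 → ℂ} (hG : ∀ k, Integrable (G k) m)
    {a : Fin N → ℂ}
    (hmul : ∀ k, ∀ g : 𝕋 → ℂ, IsHardy g → ∫ γ, G k γ * g γ ∂m = a k * ∫ γ, g γ ∂m)
    (w : Fin N → Fin N → ℂ) :
    IsAnalyticOnCircle (fun γ => ∑ k, G k γ • w k) ∧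
      fourierCoeff (fun γ => ∑ k, G k γ • w k) 0 = ∑ k, a k • w k := by
  have hcoeff : ∀ n : ℤ, n ≤ 0 → fourierCoeff (fun γ => ∑ k, G k γ • w k) n
      = ∑ k, (a k * ∫ γ, fourier (-n) γ ∂m) • w k := by
    intro n hn
    simp only [fourierCoeff, Finset.smul_sum]
    rw [integral_finsetSum _ fun k _ => ((hG k).smul_const (w k)).fourier_smul (-n)]
    refine Finset.sum_congr rfl fun k _ => ?_
    rw [← hmul k _ (isHardy_fourier (neg_nonneg.2 hn)), ← integral_smul_const]
    refine integral_congr_ae (.of_forall fun γ => ?_)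
    simp only [smul_smul, mul_comm (G k γ)]
  refine ⟨⟨integrable_finsetSum _ fun k _ => (hG k).smul_const _, fun n hn => ?_⟩, ?_⟩
  · rw [hcoeff n hn.le]
    have h := isHardy_one.2 n hn
    simp only [fourierCoeff, smul_eq_mul, mul_one] at h
    simp [-fourier_apply, h]
  · rw [hcoeff 0 le_rfl]
    simp

/-! ### The formula for the interpolated norm -/

/-- The construction of an analytic function from prescribed moduli: with `u` the norm of the
vector of moduli `φ`, the outer functions of modulus `exp (∫ log u) * φ k / u`, suitably scaled, are
the coordinates of an analytic function through `x` of norm at most `exp (∫ log u)`. -/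
lemma IsRegularLatticeFamily.interpNormZero_le_exp (H : IsRegularLatticeFamily b E)
    {x : Fin N → ℂ} {φ : Fin N → 𝕋 → ℝ} (hφ : ∀ k, AEMeasurable (φ k) m) {a A : Fin N → ℝ}
    (ha : ∀ k, 0 < a k) (hφb : ∀ k, ∀ᵐ γ ∂m, a k ≤ φ k γ ∧ φ k γ ≤ A k)
    (hx : ∀ k, ‖b.repr x k‖ ≤ Real.exp (∫ γ, Real.log (φ k γ) ∂m))
    {u : 𝕋 → ℝ} (hu : ∀ γ, u γ = E γ (∑ k, (φ k γ : ℂ) • b k)) {a' A' : ℝ} (ha' : 0 < a')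
    (hub : ∀ᵐ γ ∂m, a' ≤ u γ ∧ u γ ≤ A') :
    interpNormZero E x ≤ ENNReal.ofReal (Real.exp (∫ γ, Real.log (u γ) ∂m)) := by
  have hum : AEMeasurable u m := by
    rw [funext hu]
    refine H.aemeasurable_apply (f := fun γ => ∑ k, (φ k γ : ℂ) • b k) ?_
    exact Finset.aemeasurable_fun_sum _ fun k _ =>
      (Complex.measurable_ofReal.comp_aemeasurable (hφ k)).smul_const _
  set I : ℝ := ∫ γ, Real.log (u γ) ∂m with hI
  have hlum : AEMeasurable (fun γ => Real.log (u γ)) m :=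
    Real.measurable_log.comp_aemeasurable hum
  have hlφm : ∀ k, AEMeasurable (fun γ => Real.log (φ k γ)) m := fun k =>
    Real.measurable_log.comp_aemeasurable (hφ k)
  have hlub := ae_log_bounds ha' hub
  have hlφb := fun k => ae_log_bounds (ha k) (hφb k)
  have hlui := integrable_of_ae_bounds hlum hlub
  have hlφi := fun k => integrable_of_ae_bounds (hlφm k) (hlφb k)
  let v : Fin N → 𝕋 → ℝ := fun k γ => Real.log (φ k γ) - Real.log (u γ) + I
  have hvb : ∀ k, ∀ᵐ γ ∂m, |v k γ| ≤
      max |Real.log (a k)| |Real.log (A k)| + max |Real.log a'| |Real.log A'| + |I| := by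
    intro k
    filter_upwards [hlub, hlφb k] with γ h1 h2
    exact (abs_add_le _ _).trans (add_le_add_left ((abs_sub _ _).trans
      (add_le_add (abs_le_max_abs_abs h2.1 h2.2) (abs_le_max_abs_abs h1.1 h1.2))) _)
  have hvi : ∀ k, ∫ γ, v k γ ∂m = ∫ γ, Real.log (φ k γ) ∂m := by
    intro k
    have h1 : ∫ γ, v k γ ∂m = ∫ γ, (Real.log (φ k γ) - Real.log (u γ)) ∂m + ∫ _, I ∂m :=
      integral_add ((hlφi k).sub hlui) (integrable_const _)
    rw [h1, integral_sub (hlφi k) hlui]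
    simp [hI]
  have hvm : ∀ k, AEMeasurable (v k) m := fun k => ((hlφm k).sub hlum).add_const I
  choose G hGm hGn hG using fun k => exists_outer (hvm k) (hvb k)
  have hGi : ∀ k, Integrable (G k) m := by
    intro k
    refine Integrable.of_bound (hGm k).aestronglyMeasurable (Real.exp
      (max |Real.log (a k)| |Real.log (A k)| + max |Real.log a'| |Real.log A'| + |I|)) ?_
    filter_upwards [hGn k, hvb k] with γ h1 h2
    rw [h1]
    exact Real.exp_le_exp.2 ((le_abs_self _).trans h2)
  let t : Fin N → ℂ := fun k => b.repr x k * (Real.exp (-∫ γ, Real.log (φ k γ) ∂m) : ℂ)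
  obtain ⟨hA, hA0⟩ := isAnalyticOnCircle_sum_smul hGi hG fun k => t k • b k
  have hx0 : fourierCoeff (fun γ => ∑ k, G k γ • t k • b k) 0 = x := by
    rw [hA0]
    conv_rhs => rw [← b.sum_repr x]
    refine Finset.sum_congr rfl fun k _ => ?_
    have hexp : (Real.exp (∫ γ, v k γ ∂m) : ℂ) * (Real.exp (-∫ γ, Real.log (φ k γ) ∂m) : ℂ) = 1 := by
      rw [hvi, ← Complex.ofReal_mul, ← Real.exp_add, add_neg_cancel, Real.exp_zero,
        Complex.ofReal_one]
    rw [smul_smul]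
    congr 1
    calc _ = b.repr x k * ((Real.exp (∫ γ, v k γ ∂m) : ℂ)
          * (Real.exp (-∫ γ, Real.log (φ k γ) ∂m) : ℂ)) := by
            simp only [t]
            ring
      _ = b.repr x k := by rw [hexp, mul_one]
  refine (iInf₂_le _ ⟨hA, hx0⟩).trans (essSup_le_of_ae_le _ ?_)
  filter_upwards [H.lattice, hub, ae_all_iff.2 hφb, ae_all_iff.2 hGn] with γ hlat hγu hγφ hγG
  have hu0 : 0 < u γ := ha'.trans_le hγu.1
  refine ENNReal.ofReal_le_ofReal ?_
  have hcmp : E γ (∑ k, G k γ • t k • b k)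
      ≤ E γ (((Real.exp I / u γ : ℝ) : ℂ) • ∑ k, (φ k γ : ℂ) • b k) := by
    refine hlat _ _ fun k => ?_
    have hφ0 : 0 < φ k γ := (ha k).trans_le (hγφ k).1
    have ht : ‖t k‖ ≤ 1 := by
      rw [norm_mul, Complex.norm_real, Real.norm_of_nonneg (Real.exp_nonneg _), Real.exp_neg,
        ← div_eq_mul_inv]
      exact div_le_one_of_le₀ (hx k) (Real.exp_nonneg _)
    have hGk : ‖G k γ‖ = Real.exp I / u γ * φ k γ := by
      rw [hγG k]
      change Real.exp (Real.log (φ k γ) - Real.log (u γ) + I) = _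
      rw [Real.exp_add, Real.exp_sub, Real.exp_log hφ0, Real.exp_log hu0]
      ring
    simp only [smul_smul]
    rw [map_smul, Finsupp.smul_apply, repr_sum_smul, repr_sum_smul, norm_mul (G k γ), hGk,
      smul_eq_mul, norm_mul ((Real.exp I / u γ : ℝ) : ℂ), Complex.norm_real, Complex.norm_real, Real.norm_of_nonneg (by positivity),
      Real.norm_of_nonneg hφ0.le]
    exact mul_le_of_le_one_right (by positivity) ht
  refine hcmp.trans ?_
  rw [map_smul_eq_mul, ← hu γ, Complex.norm_real, Real.norm_of_nonneg (by positivity),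
    div_mul_cancel₀ _ hu0.ne']

lemma interpNormZero_zero (E : 𝕋 → Seminorm ℂ (Fin N → ℂ)) : interpNormZero E 0 = 0 := by
  have h : ∀ n : ℤ, fourierCoeff (fun _ : 𝕋 => (0 : Fin N → ℂ)) n = 0 := fun n => by
    simp [fourierCoeff]
  have h0 : essSup (fun γ => ENNReal.ofReal (E γ 0)) m ≤ 0 :=
    essSup_le_of_ae_le _ (.of_forall fun γ => by simp)
  exact le_antisymm ((iInf₂_le (fun _ => 0) ⟨⟨integrable_zero _ _ _, fun n _ => h n⟩, h 0⟩).trans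
    h0) bot_le

/-- Every admissible function bounds the interpolated norm. The moduli `‖f k‖` are replaced by
`‖f k‖ + ε`, which are bounded away from `0`. -/
theorem IsRegularLatticeFamily.log_interpNormZero_le (H : IsRegularLatticeFamily b E)
    {x : Fin N → ℂ} {f : 𝕋 → Fin N → ℂ} (hf : IsAdmissible b x f) :
    ENNReal.log (interpNormZero E x) ≤ logIntegral fun γ => E γ (f γ) := by
  by_cases hx : x = 0
  · rw [hx, interpNormZero_zero, ENNReal.log_zero]
    exact bot_le
  obtain ⟨k₀, -⟩ : ∃ k, b.repr x k ≠ 0 := by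
    by_contra! h
    exact hx (b.repr.map_eq_zero_iff.1 (Finsupp.ext h))
  obtain ⟨c, C, hc, hcC⟩ := H.bounds
  choose A hA using hf.bounded
  have hC0 : ∀ k, 0 < C k := by
    obtain ⟨γ, hγ⟩ := hcC.exists
    exact fun k => (hc k).trans_le ((hγ k).1.trans (hγ k).2)
  have hA0 : ∀ k, 0 ≤ A k := fun k => (norm_nonneg _).trans (hA k 0)
  set K : ℝ := ∑ k, C k with hK
  have hK0 : 0 < K := Finset.sum_pos (fun k _ => hC0 k) ⟨k₀, Finset.mem_univ _⟩
  have hfE : ∀ᵐ γ ∂m, E γ (f γ) ≤ ∑ k, A k * C k := by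
    filter_upwards [hcC] with γ hγ
    refine (seminorm_le_sum b _ _).trans (Finset.sum_le_sum fun k _ => ?_)
    exact mul_le_mul (hA k γ) (hγ k).2 (apply_nonneg _ _) (hA0 k)
  refine le_logIntegral_of_forall_add (H.aemeasurable_apply hf.measurable) hfE fun η hη => ?_
  -- `K` bounds the norm of `∑ k, b k`, so that adding `ε` to the moduli costs at most `ε * K = η`
  obtain ⟨ε, hε, hεK⟩ : ∃ ε : ℝ, 0 < ε ∧ ε * K = η := ⟨η / K, by positivity, by field_simp⟩
  let φ : Fin N → 𝕋 → ℝ := fun k γ => ‖b.repr (f γ) k‖ + ε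
  have hφm : ∀ k, AEMeasurable (φ k) m := fun k =>
    (aemeasurable_repr hf.measurable k).norm.add_const ε
  have hφb : ∀ k, ∀ᵐ γ ∂m, ε ≤ φ k γ ∧ φ k γ ≤ A k + ε := fun k => .of_forall fun γ =>
    ⟨by simp only [φ]; linarith [norm_nonneg (b.repr (f γ) k)], by
      simp only [φ]; linarith [hA k γ]⟩
  have hφx : ∀ k, ‖b.repr x k‖ ≤ Real.exp (∫ γ, Real.log (φ k γ) ∂m) := by
    intro k
    have h1 : ENNReal.log (ENNReal.ofReal ‖b.repr x k‖) ≤ logIntegral (φ k) :=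
      (hf.log_le k).trans (logIntegral_mono (.of_forall fun γ => by simp only [φ]; linarith))
    rw [logIntegral_eq_integral (hφm k) hε (hφb k), ENNReal.log_ofReal] at h1
    split_ifs at h1 with h0
    · exact h0.trans (Real.exp_nonneg _)
    · exact (Real.log_le_iff_le_exp (not_le.1 h0)).1 (EReal.coe_le_coe_iff.1 h1)
  let u : 𝕋 → ℝ := fun γ => E γ (∑ k, (φ k γ : ℂ) • b k)
  have hule : ∀ᵐ γ ∂m, u γ ≤ E γ (f γ) + η := by
    filter_upwards [hcC, H.lattice] with γ hγ hlat
    have hsplit : ∑ k, (φ k γ : ℂ) • b k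
        = ∑ k, ((‖b.repr (f γ) k‖ : ℝ) : ℂ) • b k + ∑ k, (ε : ℂ) • b k := by
      rw [← Finset.sum_add_distrib]
      refine Finset.sum_congr rfl fun k _ => ?_
      rw [← add_smul, ← Complex.ofReal_add]
    calc u γ ≤ E γ (∑ k, ((‖b.repr (f γ) k‖ : ℝ) : ℂ) • b k) + E γ (∑ k, (ε : ℂ) • b k) := by
          simp only [u]
          rw [hsplit]
          exact map_add_le_add _ _ _
      _ ≤ E γ (f γ) + ε * K := by
          refine add_le_add (hlat _ _ fun k => ?_) ((seminorm_le_sum b _ _).trans ?_)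
          · rw [repr_sum_smul, Complex.norm_real, norm_norm]
          · rw [hK, Finset.mul_sum]
            refine Finset.sum_le_sum fun k _ => ?_
            rw [repr_sum_smul, Complex.norm_real, Real.norm_of_nonneg hε.le]
            exact mul_le_mul_of_nonneg_left (hγ k).2 hε.le
      _ = E γ (f γ) + η := by rw [hεK]
  have hub : ∀ᵐ γ ∂m, ε * c k₀ ≤ u γ ∧ u γ ≤ ∑ k, A k * C k + η := by
    filter_upwards [hule, hfE, hcC, H.lattice] with γ h1 h2 h3 hlat
    refine ⟨?_, h1.trans (by linarith)⟩
    refine le_trans ?_ (hlat.norm_repr_mul_le _ k₀)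
    have hφ0 : ε ≤ φ k₀ γ := by simp only [φ]; linarith [norm_nonneg (b.repr (f γ) k₀)]
    rw [repr_sum_smul, Complex.norm_real, Real.norm_of_nonneg (hε.le.trans hφ0)]
    exact mul_le_mul hφ0 (h3 k₀).1 (hc k₀).le (hε.le.trans hφ0)
  have hum : AEMeasurable u m := by
    refine H.aemeasurable_apply (f := fun γ => ∑ k, (φ k γ : ℂ) • b k) ?_
    exact Finset.aemeasurable_fun_sum _ fun k _ =>
      (Complex.measurable_ofReal.comp_aemeasurable (hφm k)).smul_const _
  have hεc : 0 < ε * c k₀ := mul_pos hε (hc k₀)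
  have hmain := ENNReal.log_monotone (H.interpNormZero_le_exp hφm (fun _ => hε) hφb hφx
    (u := u) (fun γ => rfl) hεc hub)
  rw [ENNReal.log_ofReal, if_neg (Real.exp_pos _).not_ge, Real.log_exp,
    ← logIntegral_eq_integral hum hεc hub] at hmain
  exact hmain.trans (logIntegral_mono hule)

/-- An analytic function through `x` of finite norm agrees almost everywhere with an admissible
function; the condition on logarithmic means is Jensen's inequality for the coordinates. -/
lemma IsRegularLatticeFamily.exists_isAdmissible_ae_eq (H : IsRegularLatticeFamily b E)
    {x : Fin N → ℂ} {f : 𝕋 → Fin N → ℂ} (hf : IsAnalyticOnCircle f) (hx : fourierCoeff f 0 = x)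
    {R : ℝ} (hR : ∀ᵐ γ ∂m, E γ (f γ) ≤ R) :
    ∃ g, IsAdmissible b x g ∧ ∀ᵐ γ ∂m, g γ = f γ := by
  classical
  obtain ⟨c, C, hc, hcC⟩ := H.bounds
  have hbd : ∀ᵐ γ ∂m, ∀ k, ‖b.repr (f γ) k‖ ≤ R / c k := by
    filter_upwards [hR, hcC, H.lattice] with γ h1 h2 hlat k
    rw [le_div_iff₀ (hc k)]
    exact (mul_le_mul_of_nonneg_left (h2 k).1 (norm_nonneg _)).trans
      ((hlat.norm_repr_mul_le _ k).trans h1)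
  let g : 𝕋 → Fin N → ℂ := fun γ => if ∀ k, ‖b.repr (f γ) k‖ ≤ R / c k then f γ else 0
  have hgf : ∀ᵐ γ ∂m, g γ = f γ := by
    filter_upwards [hbd] with γ hγ
    exact if_pos hγ
  refine ⟨g, ⟨?_, fun k => ⟨|R / c k|, fun γ => ?_⟩, fun k => ?_⟩, hgf⟩
  · exact hf.1.aestronglyMeasurable.aemeasurable.congr (hgf.mono fun γ h => h.symm)
  · simp only [g]
    split_ifs with h
    · exact (h k).trans (le_abs_self _)
    · simp
  · obtain ⟨h1, h2⟩ := hf.isHardy_repr b k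
    have h3 := h1.log_norm_integral_le (hbd.mono fun γ hγ => hγ k)
    rw [h2, hx] at h3
    refine h3.trans (logIntegral_mono ?_)
    filter_upwards [hgf] with γ hγ
    rw [hγ]

/-- A lower bound for the interpolated norm may be tested on real bounds `R` of analytic functions
through `x`. -/
lemma le_interpNormZero {x : Fin N → ℂ} {y : ℝ≥0∞}
    (h : ∀ f, IsAnalyticOnCircle f → fourierCoeff f 0 = x → ∀ R : ℝ, 0 ≤ R →
      (∀ᵐ γ ∂m, E γ (f γ) ≤ R) → y ≤ ENNReal.ofReal R) : y ≤ interpNormZero E x := by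
  refine le_iInf₂ fun f hf => ?_
  set S := essSup (fun γ => ENNReal.ofReal (E γ (f γ))) m with hS
  by_cases hST : S = ⊤
  · rw [hST]
    exact le_top
  · have h1 := h f hf.1 hf.2 S.toReal ENNReal.toReal_nonneg (by
      filter_upwards [ENNReal.ae_le_essSup (μ := m) fun γ => ENNReal.ofReal (E γ (f γ))] with γ hγ
      exact (ENNReal.ofReal_le_iff_le_toReal hST).1 hγ)
    rwa [ENNReal.ofReal_toReal hST] at h1

theorem IsRegularLatticeFamily.log_interpNormZero_eq (H : IsRegularLatticeFamily b E)
    (x : Fin N → ℂ) :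
    ENNReal.log (interpNormZero E x) =
      ⨅ (f : 𝕋 → Fin N → ℂ) (_ : IsAdmissible b x f), logIntegral (fun γ => E γ (f γ)) := by
  refine le_antisymm (le_iInf₂ fun f hf => H.log_interpNormZero_le hf) ?_
  rw [← ENNReal.logOrderIso.apply_symm_apply
    (⨅ (f : 𝕋 → Fin N → ℂ) (_ : IsAdmissible b x f), logIntegral (fun γ => E γ (f γ)))]
  refine ENNReal.log_monotone (le_interpNormZero fun f hf hx R hR hfR => ?_)
  obtain ⟨g, hg, hgf⟩ := H.exists_isAdmissible_ae_eq hf hx hfR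
  rw [← ENNReal.logOrderIso.le_iff_le, OrderIso.apply_symm_apply]
  refine (iInf₂_le g hg).trans ?_
  refine le_of_le_of_eq (logIntegral_mono ?_) (logIntegral_const hR)
  filter_upwards [hgf, hfR] with γ h1 h2
  rwa [h1]

/-! ### Measure-preserving changes of the parameter -/

/-- Averaging over a Markov kernel with invariant measure `m` increases the logarithmic integral,
by Jensen's inequality for the concave function `log (· + ε)`. -/
lemma logIntegral_le_integral_kernel {M : 𝕋 → 𝕋} (hM : Measurable M) {κ : Kernel 𝕋 𝕋}
    [IsMarkovKernel κ] (hκ : m ⊗ₘ κ = m.map fun t => (M t, t)) {r : 𝕋 → ℝ} (hr : Measurable r)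
    {A : ℝ} (hr0 : ∀ t, 0 ≤ r t) (hrA : ∀ t, r t ≤ A) :
    logIntegral r ≤ logIntegral fun s => ∫ t, r t ∂κ s := by
  have hri : ∀ s, Integrable r (κ s) := fun s =>
    Integrable.of_bound hr.aestronglyMeasurable A (.of_forall fun t => by
      rw [Real.norm_of_nonneg (hr0 t)]
      exact hrA t)
  have hmean : ∀ s, 0 ≤ ∫ t, r t ∂κ s ∧ ∫ t, r t ∂κ s ≤ A := fun s =>
    ⟨integral_nonneg hr0, (integral_mono (hri s) (integrable_const A) hrA).trans (by simp)⟩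
  have hmeanm : Measurable fun s => ∫ t, r t ∂κ s :=
    (StronglyMeasurable.integral_kernel hr.stronglyMeasurable).measurable
  refine le_logIntegral_of_forall_add hmeanm.aemeasurable
    (.of_forall fun s => (hmean s).2) fun ε hε => ?_
  have hb : ∀ t, ε ≤ r t + ε ∧ r t + ε ≤ A + ε := fun t =>
    ⟨by linarith [hr0 t], by linarith [hrA t]⟩
  have hb' : ∀ s, ε ≤ ∫ t, r t ∂κ s + ε ∧ ∫ t, r t ∂κ s + ε ≤ A + ε := fun s =>
    ⟨by linarith [(hmean s).1], by linarith [(hmean s).2]⟩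
  have hlm : Measurable fun t => Real.log (r t + ε) := Real.measurable_log.comp (hr.add_const ε)
  have hlb : ∀ t, ‖Real.log (r t + ε)‖ ≤ max |Real.log ε| |Real.log (A + ε)| := fun t =>
    abs_le_max_abs_abs (Real.log_le_log hε (hb t).1)
      (Real.log_le_log (hε.trans_le (hb t).1) (hb t).2)
  refine (logIntegral_mono (.of_forall fun t => by linarith : ∀ᵐ t ∂m, r t ≤ r t + ε)).trans ?_
  rw [logIntegral_eq_integral (hr.add_const ε).aemeasurable hε (.of_forall hb),
    logIntegral_eq_integral (hmeanm.add_const ε).aemeasurable hε (.of_forall hb'),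
    EReal.coe_le_coe_iff]
  have hdis : ∫ t, Real.log (r t + ε) ∂m = ∫ s, ∫ t, Real.log (r t + ε) ∂κ s ∂m := by
    have h1 := Measure.integral_compProd (μ := m) (κ := κ)
      (f := fun q : 𝕋 × 𝕋 => Real.log (r q.2 + ε))
      (Integrable.of_bound (hlm.comp measurable_snd).aestronglyMeasurable _
        (.of_forall fun q => hlb q.2))
    have hpair : Measurable fun t : 𝕋 => (M t, t) := hM.prodMk measurable_id
    have hsnd : Measurable fun q : 𝕋 × 𝕋 => Real.log (r q.2 + ε) := hlm.comp measurable_snd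
    rw [← h1, hκ, integral_map hpair.aemeasurable hsnd.aestronglyMeasurable]
  rw [hdis]
  refine integral_mono (Integrable.of_bound
    (StronglyMeasurable.integral_kernel hlm.stronglyMeasurable).aestronglyMeasurable
      (max |Real.log ε| |Real.log (A + ε)|) (.of_forall fun s => ?_))
    (integrable_of_ae_bounds (Real.measurable_log.comp (hmeanm.add_const ε)).aemeasurable
      (ae_log_bounds hε (.of_forall hb'))) fun s => ?_
  · simpa using norm_integral_le_of_norm_le_const (μ := κ s) (.of_forall hlb)
  · have hconc : ConcaveOn ℝ (Set.Icc ε (A + ε)) Real.log :=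
      strictConcaveOn_log_Ioi.concaveOn.subset (fun y hy => hε.trans_le hy.1) (convex_Icc _ _)
    have hcont : ContinuousOn Real.log (Set.Icc ε (A + ε)) :=
      Real.continuousOn_log.mono fun y hy => (hε.trans_le hy.1).ne'
    have h := hconc.le_map_integral (μ := κ s) (f := fun t => r t + ε) hcont isClosed_Icc
      (.of_forall hb) ((hri s).add (integrable_const ε))
      (Integrable.of_bound hlm.aestronglyMeasurable _ (.of_forall hlb))
    rw [integral_add (hri s) (integrable_const ε)] at h
    simpa using h

/-- The interpolated norm does not increase on passing from `γ ↦ E (M γ)` to `E`: the moduli of the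
coordinates of an analytic function are averaged over the fibres of `M`. Averaging preserves the
bound on the norm, by convexity, and increases the logarithmic means. -/
theorem IsRegularLatticeFamily.interpNormZero_le_comp (H : IsRegularLatticeFamily b E)
    {M : 𝕋 → 𝕋} (hM : MeasurePreserving M m m) (x : Fin N → ℂ) :
    interpNormZero E x ≤ interpNormZero (fun γ => E (M γ)) x := by
  refine le_interpNormZero fun f hf hx R hR hfR => ?_
  obtain ⟨g, hg, hgf⟩ := (H.comp hM).exists_isAdmissible_ae_eq hf hx hfR
  choose A hA using hg.bounded
  have hA0 : ∀ k, 0 ≤ A k := fun k => (norm_nonneg _).trans (hA k 0)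
  obtain ⟨E', hE', hEE'⟩ := exists_measurable_modification H.measurable
  -- the moduli of the coordinates, in a version that is measurable and bounded everywhere
  let r : Fin N → 𝕋 → ℝ := fun k t => min ‖b.repr (hg.measurable.mk g t) k‖ (A k)
  have hr : ∀ k, Measurable (r k) := fun k =>
    (((b.coord k).continuous_of_finiteDimensional.measurable).comp
      hg.measurable.measurable_mk).norm.min measurable_const
  have hr0 : ∀ k t, 0 ≤ r k t := fun k t => le_min (norm_nonneg _) (hA0 k)
  have hrA : ∀ k t, r k t ≤ A k := fun k t => min_le_right _ _
  have hrg : ∀ᵐ t ∂m, ∀ k, r k t = ‖b.repr (g t) k‖ := by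
    filter_upwards [hg.measurable.ae_eq_mk] with t ht k
    simp only [r]
    rw [← ht, min_eq_left (hA k t)]
  let F : 𝕋 → Fin N → ℂ := fun t => ∑ k, (r k t : ℂ) • b k
  have hFm : Measurable F := Finset.measurable_fun_sum _ fun k _ =>
    (Complex.measurable_ofReal.comp (hr k)).smul_const _
  have hFR : ∀ᵐ t ∂m, E' (M t) (F t) ≤ R := by
    have hEM : ∀ᵐ t ∂m, E (M t) = E' (M t) :=
      hM.quasiMeasurePreserving.ae (p := fun γ => E γ = E' γ) hEE'
    filter_upwards [hrg, hgf, hfR, (H.comp hM).lattice, hEM] with t h1 h2 h3 h4 h5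
    rw [← h5]
    refine le_trans (h4 _ _ fun k => ?_) h3
    rw [repr_sum_smul, h1, h2, Complex.norm_real, norm_norm]
  let κ : Kernel 𝕋 𝕋 := condDistrib id M m
  have hκ : m ⊗ₘ κ = m.map fun t => (M t, t) := by
    have h : m.map M ⊗ₘ κ = m.map fun t => (M t, id t) := compProd_map_condDistrib aemeasurable_id
    rwa [hM.map_eq] at h
  have hFκ : ∀ᵐ s ∂m, ∀ᵐ t ∂κ s, E' s (F t) ≤ R := by
    refine Measure.ae_ae_of_ae_compProd (p := fun q : 𝕋 × 𝕋 => E' q.1 (F q.2) ≤ R) ?_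
    have hpair : Measurable fun t : 𝕋 => (M t, t) := hM.measurable.prodMk measurable_id
    rw [hκ, ae_map_iff hpair.aemeasurable]
    · exact hFR
    · exact measurableSet_le (hE'.comp ((hFm.comp measurable_snd).prodMk measurable_fst))
        measurable_const
  have hFi : ∀ s, Integrable F (κ s) := fun s =>
    integrable_finsetSum _ fun k _ => (Integrable.of_bound
      (Complex.measurable_ofReal.comp (hr k)).aestronglyMeasurable (A k) (.of_forall fun t => by
        simp only [Function.comp_apply]
        rw [Complex.norm_real, Real.norm_of_nonneg (hr0 k t)]
        exact hrA k t)).smul_const _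
  have hrepr : ∀ s k, b.repr (∫ t, F t ∂κ s) k = ((∫ t, r k t ∂κ s : ℝ) : ℂ) := by
    intro s k
    have h := (LinearMap.toContinuousLinearMap (b.coord k)).integral_comp_comm (hFi s)
    refine h.symm.trans ?_
    rw [← integral_complex_ofReal]
    refine integral_congr_ae (.of_forall fun t => ?_)
    exact repr_sum_smul b (fun k => (r k t : ℂ)) k
  have hnorm : ∀ s k, ‖b.repr (∫ t, F t ∂κ s) k‖ = ∫ t, r k t ∂κ s := fun s k => by
    rw [hrepr, Complex.norm_real, Real.norm_of_nonneg (integral_nonneg (hr0 k))]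
  have hadm : IsAdmissible b x fun s => ∫ t, F t ∂κ s := by
    refine ⟨?_, fun k => ⟨A k, fun s => ?_⟩, fun k => ?_⟩
    · exact (StronglyMeasurable.integral_kernel hFm.stronglyMeasurable).measurable.aemeasurable
    · rw [hrepr, Complex.norm_real]
      refine (norm_integral_le_of_norm_le_const (C := A k) (.of_forall fun t => ?_)).trans ?_
      · rw [Real.norm_of_nonneg (hr0 k t)]
        exact hrA k t
      · simp
    · simp only [hnorm]
      refine (hg.log_le k).trans ((logIntegral_mono ?_).trans
        (logIntegral_le_integral_kernel hM.measurable hκ (hr k) (hr0 k) (hrA k)))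
      filter_upwards [hrg] with t ht
      exact (ht k).ge
  rw [← ENNReal.logOrderIso.le_iff_le]
  refine (H.log_interpNormZero_le hadm).trans
    (le_of_le_of_eq (logIntegral_mono ?_) (logIntegral_const hR))
  filter_upwards [hFκ, hEE'] with s hs hEs
  rw [hEs]
  have hconv : Convex ℝ {y | E' s y ≤ R} := by
    simpa using (Seminorm.convexOn (E' s)).convex_le R
  exact hconv.integral_mem (isClosed_le (continuous_seminorm _) continuous_const) hs (hFi s)

lemma IsAdmissible.comp {x : Fin N → ℂ} {f : 𝕋 → Fin N → ℂ} (hf : IsAdmissible b x f)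
    {M : 𝕋 → 𝕋} (hM : MeasurePreserving M m m) : IsAdmissible b x fun γ => f (M γ) := by
  refine ⟨hf.measurable.comp_quasiMeasurePreserving hM.quasiMeasurePreserving, fun k => ?_,
    fun k => ?_⟩
  · obtain ⟨C, hC⟩ := hf.bounded k
    exact ⟨C, fun γ => hC (M γ)⟩
  · exact (hf.log_le k).trans_eq
      (logIntegral_comp hM (aemeasurable_repr hf.measurable k).norm).symm

theorem IsRegularLatticeFamily.interpNormZero_comp (H : IsRegularLatticeFamily b E)
    {M : 𝕋 → 𝕋} (hM : MeasurePreserving M m m) (x : Fin N → ℂ) :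
    interpNormZero (fun γ => E (M γ)) x = interpNormZero E x := by
  refine le_antisymm ?_ (H.interpNormZero_le_comp hM x)
  rw [← ENNReal.logOrderIso.le_iff_le]
  change ENNReal.log _ ≤ ENNReal.log _
  rw [H.log_interpNormZero_eq x]
  refine le_iInf₂ fun f hf => ?_
  exact ((H.comp hM).log_interpNormZero_le (hf.comp hM)).trans_eq
    (logIntegral_comp hM (g := fun γ => E γ (f γ)) (H.aemeasurable_apply hf.measurable))

end LatticeInterp


open LatticeInterp in
theorem mainTheorem9 {N : ℕ} (b : Module.Basis (Fin N) ℂ (Fin N → ℂ))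
    (E : 𝕋 → Seminorm ℂ (Fin N → ℂ))
    (hE : IsInterpolationFamily E) (hL : IsCompatibleLatticeFamily b E) :
    (∀ x : Fin N → ℂ,
      ENNReal.log (interpNormZero E x) =
        ⨅ (f : 𝕋 → Fin N → ℂ) (_ : IsAdmissible b x f), logIntegral (fun γ => E γ (f γ))) ∧
    (∀ M : 𝕋 → 𝕋, MeasurePreserving M m m →
      ∀ x : Fin N → ℂ, interpNormZero (fun γ => E (M γ)) x = interpNormZero E x) := by
  have H := hL.isRegularLatticeFamily hE
  exact ⟨H.log_interpNormZero_eq, fun M hM x => H.interpNormZero_comp hM x⟩
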